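/- Let $m$ be Lebesgue measure on $[0,1]$, let $L^\infty=L^\infty([0,1],m)$ be the real Banach space of essentially bounded functions, and let $\mathcal{B}(L^\infty)$ be the Banach algebra of bounded linear operators on it. Let $$\mathcal{I}=\Big\{T\in\mathcal{B}(L^\infty):\ \lim_{t\to 1^-}\|T\circ(1_{[t,1]}\cdot \mathrm{I})\|=0\Big\},$$ where $1_{[t,1]}\cdot\mathrm{I}$ is the operator $f\mapsto 1_{[t,1]}f$; this is a left ideal. Put $$\mathcal{A}=\mathcal{B}(L^\infty)\cap\mathcal{I}^{\bot\bot}\subset\mathcal{B}(L^\infty)^{**},$$ with $\mathcal{B}(L^\infty)$ canonically embedded in its bidual. Let $\mathfrak{M}$ be the Stone space of the measure algebra $\mathrm{Bor}([0,1])/\ker(m)$, that is, the compact space of its ultrafilters, and identify $C(\mathfrak{M})$ with $L^\infty$ by the canonical isometry, under which the value of $f\in L^\infty$ at $u\in\mathfrak{M}$ is the limit of $f$ along $u$. Let $$M=\{u\in\mathfrak{M}:\ [0,1]\setminus[0,t]\in u\ \text{ for every } t<1\}.$$ Then $\mathcal{A}$ is a left ideal of $\mathcal{B}(L^\infty)$.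 Moreover, for every $T\in\mathcal{A}$ and every $x^*\in C(\mathfrak{M})^*$, the functional $x^*\circ T\in C(\mathfrak{M})^*$ is given by integration against a regular signed Borel measure on $\mathfrak{M}$, and every regular signed Borel measure $\mu$ on $\mathfrak{M}$ that represents $x^*\circ T$ in this way satisfies $|\mu|(M)=0$, where $|\mu|$ is the total variation measure of $\mu$. -/

import Mathlib

open MeasureTheory Filter Topology Set
open scoped ENNReal unitInterval

noncomputable section

namespace Stone

/-- An ultrafilter on a Boolean algebra. -/
@[ext]
structure BoolUltrafilter (B : Type*) [BooleanAlgebra B] where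
  /-- The underlying set of elements. -/
  carrier : Set B
  top_mem : ⊤ ∈ carrier
  bot_notMem : ⊥ ∉ carrier
  inf_mem : ∀ a b, a ∈ carrier → b ∈ carrier → a ⊓ b ∈ carrier
  mem_of_le : ∀ a b, a ≤ b → a ∈ carrier → b ∈ carrier
  mem_or_compl_mem : ∀ a, a ∈ carrier ∨ aᶜ ∈ carrier

section StoneSpace

variable {B : Type*} [BooleanAlgebra B]

/-- The basic clopen set of the Stone space given by `a`: all ultrafilters that contain `a`. -/
def basicClopen (a : B) : Set (BoolUltrafilter B) := {u | a ∈ u.carrier}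

/-- The Stone topology: it is generated by the sets `basicClopen a`. -/
instance : TopologicalSpace (BoolUltrafilter B) :=
  TopologicalSpace.generateFrom (Set.range basicClopen)

instance : MeasurableSpace (BoolUltrafilter B) := borel _

instance : BorelSpace (BoolUltrafilter B) := ⟨rfl⟩

theorem compl_mem_iff (u : BoolUltrafilter B) (a : B) : aᶜ ∈ u.carrier ↔ a ∉ u.carrier := by
  constructor
  · intro h h'
    have := u.inf_mem _ _ h' h
    rw [inf_compl_eq_bot] at this
    exact u.bot_notMem this
  · intro h
    exact (u.mem_or_compl_mem a).resolve_left h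

theorem isOpen_basicClopen (a : B) : IsOpen (basicClopen a) :=
  TopologicalSpace.isOpen_generateFrom_of_mem ⟨a, rfl⟩

theorem basicClopen_compl (a : B) : basicClopen aᶜ = (basicClopen a)ᶜ := by
  ext u
  exact compl_mem_iff u a

instance : T2Space (BoolUltrafilter B) := by
  refine ⟨fun u v huv => ?_⟩
  obtain ⟨a, ha, hb⟩ : ∃ a, a ∈ u.carrier ∧ a ∉ v.carrier := by
    by_contra! h
    apply huv
    ext a
    refine ⟨h a, fun hv => ?_⟩
    by_contra hu
    exact (compl_mem_iff v a).1 (h _ ((compl_mem_iff u a).2 hu)) hv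
  refine ⟨basicClopen a, basicClopen aᶜ, isOpen_basicClopen _, isOpen_basicClopen _, ha,
    (compl_mem_iff v a).2 hb, ?_⟩
  rw [basicClopen_compl]
  exact disjoint_compl_right

instance : CompactSpace (BoolUltrafilter B) := by
  refine ⟨isCompact_iff_ultrafilter_le_nhds.2 fun W _ => ?_⟩
  let u : BoolUltrafilter B :=
    { carrier := {a | basicClopen a ∈ W}
      top_mem := by
        have : basicClopen (⊤ : B) = Set.univ := by
          ext v
          simp [basicClopen, v.top_mem]
        change basicClopen ⊤ ∈ W
        rw [this]
        exact univ_mem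
      bot_notMem := by
        have : basicClopen (⊥ : B) = ∅ := by
          ext v
          simp [basicClopen, v.bot_notMem]
        change basicClopen ⊥ ∉ W
        rw [this]
        exact W.empty_notMem
      inf_mem := fun a b ha hb =>
        W.mem_of_superset (W.inter_mem ha hb) fun v hv => v.inf_mem a b hv.1 hv.2
      mem_of_le := fun a b hab ha => W.mem_of_superset ha fun v hv => v.mem_of_le a b hab hv
      mem_or_compl_mem := fun a => by
        change basicClopen a ∈ W ∨ basicClopen aᶜ ∈ W
        rw [basicClopen_compl]
        exact Ultrafilter.mem_or_compl_mem W _ }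
  refine ⟨u, Set.mem_univ _, ?_⟩
  rw [TopologicalSpace.nhds_generateFrom]
  refine le_iInf₂ fun s hs => ?_
  obtain ⟨hus, a, rfl⟩ := hs
  exact le_principal_iff.2 hus

end StoneSpace

section MeasureAlgebra

variable {α : Type*} [MeasurableSpace α]

/-- Equality of measurable sets up to a null set. -/
def aeSetoid (μ : Measure α) : Setoid (Subtype (MeasurableSet : Set α → Prop)) where
  r A C := ∀ᵐ x ∂μ, x ∈ (A : Set α) ↔ x ∈ (C : Set α)
  iseqv := ⟨fun _ => Eventually.of_forall fun _ => Iff.rfl, fun h => h.mono fun _ hx => hx.symm,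
    fun h h' => (h.and h').mono fun _ hx => hx.1.trans hx.2⟩

/-- The measure algebra: measurable sets modulo null sets. -/
def MeasureAlgebra (μ : Measure α) : Type _ := Quotient (aeSetoid μ)

variable {μ : Measure α}

/-- The class of a measurable set in the measure algebra. -/
def MeasureAlgebra.mk (μ : Measure α) (A : Set α) (hA : MeasurableSet A) : MeasureAlgebra μ :=
  Quotient.mk (aeSetoid μ) ⟨A, hA⟩

/-- The Boolean operations are those of sets, and `[A] ≤ [C]` means that `A \ C` is null. -/
instance : BooleanAlgebra (MeasureAlgebra μ) where
  le := Quotient.lift₂ (fun A C => ∀ᵐ x ∂μ, x ∈ (A : Set α) → x ∈ (C : Set α))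
    fun A C A' C' (h : ∀ᵐ x ∂μ, x ∈ (A : Set α) ↔ x ∈ (A' : Set α))
      (h' : ∀ᵐ x ∂μ, x ∈ (C : Set α) ↔ x ∈ (C' : Set α)) => propext <| eventually_congr <|
        (h.and h').mono fun _ hx => imp_congr hx.1 hx.2
  sup := Quotient.map₂ (· ⊔ ·) fun A A' (h : ∀ᵐ x ∂μ, x ∈ (A : Set α) ↔ x ∈ (A' : Set α))
    C C' (h' : ∀ᵐ x ∂μ, x ∈ (C : Set α) ↔ x ∈ (C' : Set α)) =>
      (h.and h').mono fun _ hx => or_congr hx.1 hx.2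
  inf := Quotient.map₂ (· ⊓ ·) fun A A' (h : ∀ᵐ x ∂μ, x ∈ (A : Set α) ↔ x ∈ (A' : Set α))
    C C' (h' : ∀ᵐ x ∂μ, x ∈ (C : Set α) ↔ x ∈ (C' : Set α)) =>
      (h.and h').mono fun _ hx => and_congr hx.1 hx.2
  compl := Quotient.map (·ᶜ) fun A A' (h : ∀ᵐ x ∂μ, x ∈ (A : Set α) ↔ x ∈ (A' : Set α)) =>
    h.mono fun _ hx => not_congr hx
  top := Quotient.mk _ ⊤
  bot := Quotient.mk _ ⊥
  le_refl := by rintro ⟨A⟩; exact Eventually.of_forall fun _ h => h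
  le_trans := by
    rintro ⟨A⟩ ⟨C⟩ ⟨D⟩ h h'
    filter_upwards [h, h'] with x hx hx' hh
    exact hx' (hx hh)
  le_antisymm := by
    rintro ⟨A⟩ ⟨C⟩ h h'
    refine Quotient.sound ?_
    change ∀ᵐ x ∂μ, x ∈ (A : Set α) ↔ x ∈ (C : Set α)
    filter_upwards [h, h'] with x hx hx'
    exact ⟨hx, hx'⟩
  le_sup_left := by rintro ⟨A⟩ ⟨C⟩; exact Eventually.of_forall fun _ h => Or.inl h
  le_sup_right := by rintro ⟨A⟩ ⟨C⟩; exact Eventually.of_forall fun _ h => Or.inr h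
  sup_le := by
    rintro ⟨A⟩ ⟨C⟩ ⟨D⟩ h h'
    filter_upwards [h, h'] with x hx hx' hh
    exact hh.elim hx hx'
  inf_le_left := by rintro ⟨A⟩ ⟨C⟩; exact Eventually.of_forall fun _ h => h.1
  inf_le_right := by rintro ⟨A⟩ ⟨C⟩; exact Eventually.of_forall fun _ h => h.2
  le_inf := by
    rintro ⟨A⟩ ⟨C⟩ ⟨D⟩ h h'
    filter_upwards [h, h'] with x hx hx' hh
    exact ⟨hx hh, hx' hh⟩
  le_sup_inf := by
    rintro ⟨A⟩ ⟨C⟩ ⟨D⟩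
    refine Eventually.of_forall fun x h => ?_
    rcases h with ⟨h1 | h1, h2 | h2⟩
    · exact Or.inl h1
    · exact Or.inl h1
    · exact Or.inl h2
    · exact Or.inr ⟨h1, h2⟩
  le_top := by rintro ⟨A⟩; exact Eventually.of_forall fun _ _ => trivial
  bot_le := by rintro ⟨A⟩; exact Eventually.of_forall fun _ h => h.elim
  inf_compl_le_bot := by rintro ⟨A⟩; exact Eventually.of_forall fun _ h => h.2 h.1
  top_le_sup_compl := by rintro ⟨A⟩; exact Eventually.of_forall fun x _ => Classical.em _

theorem MeasureAlgebra.mk_le_mk {A C : Set α} (hA : MeasurableSet A) (hC : MeasurableSet C)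
    (h : ∀ᵐ x ∂μ, x ∈ A → x ∈ C) : MeasureAlgebra.mk μ A hA ≤ MeasureAlgebra.mk μ C hC := h

/-- The filter of subsets of the underlying space that is generated by the measurable sets whose
classes belong to the ultrafilter `u` on the measure algebra. -/
def pointFilter (u : BoolUltrafilter (MeasureAlgebra μ)) : Filter α where
  sets := {S | ∃ (A : Set α) (hA : MeasurableSet A), A ⊆ S ∧ MeasureAlgebra.mk μ A hA ∈ u.carrier}
  univ_sets := ⟨Set.univ, MeasurableSet.univ, subset_rfl, u.top_mem⟩
  sets_of_superset := by
    rintro S S' ⟨A, hA, hAS, hAu⟩ h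
    exact ⟨A, hA, hAS.trans h, hAu⟩
  inter_sets := by
    rintro S S' ⟨A, hA, hAS, hAu⟩ ⟨C, hC, hCS, hCu⟩
    exact ⟨A ∩ C, hA.inter hC, Set.inter_subset_inter hAS hCS, u.inf_mem _ _ hAu hCu⟩

theorem mem_pointFilter {u : BoolUltrafilter (MeasureAlgebra μ)} {A : Set α}
    (hA : MeasurableSet A) : A ∈ pointFilter u ↔ MeasureAlgebra.mk μ A hA ∈ u.carrier := by
  constructor
  · rintro ⟨C, hC, hCA, hCu⟩
    exact u.mem_of_le _ _ (MeasureAlgebra.mk_le_mk hC hA (Eventually.of_forall fun _ hx => hCA hx)) hCu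
  · intro h
    exact ⟨A, hA, subset_rfl, h⟩

instance (u : BoolUltrafilter (MeasureAlgebra μ)) : (pointFilter u).NeBot := by
  refine ⟨fun h => ?_⟩
  have h0 : (∅ : Set α) ∈ pointFilter u := by rw [h]; trivial
  exact u.bot_notMem ((mem_pointFilter MeasurableSet.empty).1 h0)

theorem pointFilter_le_ae (u : BoolUltrafilter (MeasureAlgebra μ)) : pointFilter u ≤ ae μ := by
  intro S hS
  have h0 : μ Sᶜ = 0 := hS
  have hm := measurableSet_toMeasurable μ Sᶜ
  have h1 : μ (toMeasurable μ Sᶜ) = 0 := by rw [measure_toMeasurable, h0]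
  refine ⟨(toMeasurable μ Sᶜ)ᶜ, hm.compl, ?_, ?_⟩
  · exact Set.compl_subset_comm.1 (subset_toMeasurable μ Sᶜ)
  · refine u.mem_of_le ⊤ _ ?_ u.top_mem
    refine MeasureAlgebra.mk_le_mk MeasurableSet.univ hm.compl ?_
    filter_upwards [measure_eq_zero_iff_ae_notMem.1 h1] with x hx _
    exact hx

theorem ae_norm_le_norm (f : Lp ℝ ∞ μ) : ∀ᵐ x ∂μ, ‖f x‖ ≤ ‖f‖ := by
  filter_upwards [enorm_ae_le_eLpNormEssSup f μ] with x hx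
  rw [Lp.norm_def, eLpNorm_exponent_top, ← toReal_enorm]
  refine ENNReal.toReal_mono ?_ hx
  rw [← eLpNorm_exponent_top]
  exact Lp.eLpNorm_ne_top f

theorem norm_le_of_ae_bound {f : Lp ℝ ∞ μ} {r : ℝ} (hr : 0 ≤ r) (h : ∀ᵐ x ∂μ, ‖f x‖ ≤ r) :
    ‖f‖ ≤ r := by
  rw [Lp.norm_def, eLpNorm_exponent_top]
  exact ENNReal.toReal_le_of_le_ofReal hr (eLpNormEssSup_le_of_ae_bound h)

theorem exists_tendsto_pointFilter (f : Lp ℝ ∞ μ) (u : BoolUltrafilter (MeasureAlgebra μ)) :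
    ∃ c, Tendsto f (pointFilter u) (𝓝 c) := by
  have hf : Measurable f := (Lp.stronglyMeasurable f).measurable
  have hb : ∀ᶠ x in pointFilter u, f x ∈ Metric.closedBall (0 : ℝ) ‖f‖ := by
    refine pointFilter_le_ae u ?_
    filter_upwards [ae_norm_le_norm f] with x hx
    exact mem_closedBall_zero_iff.2 hx
  obtain ⟨c, -, hc⟩ := (isCompact_closedBall (0 : ℝ) ‖f‖).exists_clusterPt
    (f := map f (pointFilter u)) (le_principal_iff.2 hb)
  refine ⟨c, Metric.tendsto_nhds.2 fun ε hε => ?_⟩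
  have hS : MeasurableSet {x | dist (f x) c < ε} :=
    measurableSet_lt (hf.dist measurable_const) measurable_const
  by_contra hn
  have hn' : {x | dist (f x) c < ε}ᶜ ∈ pointFilter u := by
    rw [mem_pointFilter hS.compl]
    refine (compl_mem_iff u (MeasureAlgebra.mk μ _ hS)).2 fun h => hn ?_
    exact (mem_pointFilter hS).2 h
  have : (Metric.ball c ε)ᶜ ∈ map f (pointFilter u) := hn'
  obtain ⟨y, hy, hy'⟩ := clusterPt_iff_nonempty.1 hc (Metric.ball_mem_nhds c hε) this
  exact hy' hy

/-- The value at the point `u` of the Stone space of the continuous function that corresponds to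
`f ∈ L^∞`: the limit of `f` along the ultrafilter `u`. -/
def stoneValue (f : Lp ℝ ∞ μ) (u : BoolUltrafilter (MeasureAlgebra μ)) : ℝ :=
  limUnder (pointFilter u) f

theorem tendsto_stoneValue (f : Lp ℝ ∞ μ) (u : BoolUltrafilter (MeasureAlgebra μ)) :
    Tendsto f (pointFilter u) (𝓝 (stoneValue f u)) :=
  tendsto_nhds_limUnder (exists_tendsto_pointFilter f u)

theorem stoneValue_eq {f : Lp ℝ ∞ μ} {u : BoolUltrafilter (MeasureAlgebra μ)} {g : α → ℝ} {c : ℝ}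
    (hfg : f =ᵐ[μ] g) (h : Tendsto g (pointFilter u) (𝓝 c)) : stoneValue f u = c :=
  tendsto_nhds_unique (tendsto_stoneValue f u)
    (h.congr' (pointFilter_le_ae u (hfg.mono fun _ hx => hx.symm)))

theorem continuous_stoneValue (f : Lp ℝ ∞ μ) :
    Continuous (stoneValue f : BoolUltrafilter (MeasureAlgebra μ) → ℝ) := by
  have hf : Measurable f := (Lp.stronglyMeasurable f).measurable
  refine continuous_iff_continuousAt.2 fun u => Metric.tendsto_nhds.2 fun ε hε => ?_
  have hS : MeasurableSet {x | dist (f x) (stoneValue f u) < ε / 2} :=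
    measurableSet_lt (hf.dist measurable_const) measurable_const
  have hu : {x | dist (f x) (stoneValue f u) < ε / 2} ∈ pointFilter u :=
    Metric.tendsto_nhds.1 (tendsto_stoneValue f u) (ε / 2) (half_pos hε)
  have hmem : basicClopen (MeasureAlgebra.mk μ _ hS) ∈ 𝓝 u :=
    (isOpen_basicClopen _).mem_nhds ((mem_pointFilter hS).1 hu)
  filter_upwards [hmem] with v hv
  have hv' : {x | dist (f x) (stoneValue f u) < ε / 2} ∈ pointFilter v :=
    (mem_pointFilter hS).2 hv
  have : dist (stoneValue f v) (stoneValue f u) ≤ ε / 2 :=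
    le_of_tendsto ((tendsto_stoneValue f v).dist tendsto_const_nhds)
      ((show ∀ᶠ x in pointFilter v, dist (f x) (stoneValue f u) < ε / 2 from hv').mono
        fun _ hx => hx.le)
  linarith

/-- The continuous function on the Stone space that corresponds to `f ∈ L^∞`. -/
def stoneMap (f : Lp ℝ ∞ μ) : C(BoolUltrafilter (MeasureAlgebra μ), ℝ) :=
  ⟨stoneValue f, continuous_stoneValue f⟩

/-- The ultrafilter on the measure algebra given by an ultrafilter of sets containing all sets of
full measure. -/
def ofUltrafilter (W : Ultrafilter α) (hW : (W : Filter α) ≤ ae μ) :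
    BoolUltrafilter (MeasureAlgebra μ) where
  carrier := {a | Quotient.liftOn a (fun A => (A : Set α) ∈ W) fun A C h => propext
    (eventually_congr (f := (W : Filter α)) (hW h))}
  top_mem := by
    change (Set.univ : Set α) ∈ W
    exact univ_mem
  bot_notMem := by
    change (∅ : Set α) ∉ W
    exact W.empty_notMem
  inf_mem := by
    rintro ⟨A⟩ ⟨C⟩ hA hC
    exact W.inter_mem hA hC
  mem_of_le := by
    rintro ⟨A⟩ ⟨C⟩ h hA
    have h' : ∀ᶠ x in (W : Filter α), x ∈ (A : Set α) → x ∈ (C : Set α) := hW h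
    have hA' : ∀ᶠ x in (W : Filter α), x ∈ (A : Set α) := hA
    exact (h'.and hA').mono fun x hx => hx.1 hx.2
  mem_or_compl_mem := by
    rintro ⟨A⟩
    exact Ultrafilter.mem_or_compl_mem W _

theorem norm_stoneMap (f : Lp ℝ ∞ μ) : ‖stoneMap f‖ = ‖f‖ := by
  apply le_antisymm
  · refine (ContinuousMap.norm_le _ (norm_nonneg _)).2 fun u => ?_
    exact le_of_tendsto (tendsto_stoneValue f u).norm
      (pointFilter_le_ae u (ae_norm_le_norm f))
  · refine le_of_forall_lt_imp_le_of_dense fun r hr => ?_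
    rcases lt_or_ge r 0 with h0 | h0
    · exact h0.le.trans (norm_nonneg _)
    have hS : MeasurableSet {x | r < ‖f x‖} :=
      measurableSet_lt measurable_const (Lp.stronglyMeasurable f).measurable.norm
    have hfreq : ∃ᶠ x in ae μ, r < ‖f x‖ := by
      intro hle
      refine hr.not_ge (norm_le_of_ae_bound h0 ?_)
      filter_upwards [hle] with x hx
      exact not_lt.1 hx
    have hne : (ae μ ⊓ 𝓟 {x | r < ‖f x‖}).NeBot := frequently_mem_iff_neBot.1 hfreq
    obtain ⟨W, hW⟩ := Ultrafilter.exists_le (ae μ ⊓ 𝓟 {x | r < ‖f x‖})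
    let u := ofUltrafilter W (hW.trans inf_le_left)
    have hu : {x | r < ‖f x‖} ∈ pointFilter u :=
      (mem_pointFilter hS).2 (le_principal_iff.1 (hW.trans inf_le_right))
    have h1 : r ≤ ‖stoneValue f u‖ :=
      ge_of_tendsto (tendsto_stoneValue f u).norm ((show ∀ᶠ x in pointFilter u, r < ‖f x‖ from hu).mono
        fun _ hx => hx.le)
    exact h1.trans ((stoneMap f).norm_coe_le_norm u)

/-- The linear isometry `L^∞ → C(𝔐)`. -/
def stoneLI (μ : Measure α) : Lp ℝ ∞ μ →ₗᵢ[ℝ] C(BoolUltrafilter (MeasureAlgebra μ), ℝ) where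
  toFun := stoneMap
  map_add' f g := by
    ext u
    exact stoneValue_eq (Lp.coeFn_add f g) ((tendsto_stoneValue f u).add (tendsto_stoneValue g u))
  map_smul' c f := by
    ext u
    exact stoneValue_eq (Lp.coeFn_smul c f) ((tendsto_stoneValue f u).const_smul c)
  norm_map' := norm_stoneMap

theorem memLp_indicator_one (μ : Measure α) {A : Set α} (hA : MeasurableSet A) :
    MemLp (A.indicator fun _ => (1 : ℝ)) ∞ μ :=
  (memLp_top_const (1 : ℝ)).indicator hA

/-- `stoneMap` sends the indicator function of `A` to that of the clopen set given by `A`. -/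
theorem stoneMap_indicator {A : Set α} (hA : MeasurableSet A)
    (u : BoolUltrafilter (MeasureAlgebra μ)) :
    stoneMap (memLp_indicator_one μ hA).toLp u =
      (basicClopen (MeasureAlgebra.mk μ A hA)).indicator (fun _ => (1 : ℝ)) u := by
  refine stoneValue_eq (memLp_indicator_one μ hA).coeFn_toLp ?_
  by_cases h : u ∈ basicClopen (MeasureAlgebra.mk μ A hA)
  · rw [Set.indicator_of_mem h]
    refine tendsto_const_nhds.congr' ?_
    filter_upwards [(mem_pointFilter hA).2 h] with x hx
    simp [hx]
  · rw [Set.indicator_of_notMem h]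
    refine tendsto_const_nhds.congr' ?_
    have h' : Aᶜ ∈ pointFilter u := (mem_pointFilter hA.compl).2 ((compl_mem_iff u _).2 h)
    filter_upwards [h'] with x hx
    exact (Set.indicator_of_notMem hx _).symm

theorem stoneLI_surjective (μ : Measure α) : Function.Surjective (stoneLI μ) := by
  let R : Subalgebra ℝ C(BoolUltrafilter (MeasureAlgebra μ), ℝ) :=
    { carrier := Set.range (stoneLI μ)
      mul_mem' := by
        rintro _ _ ⟨f, rfl⟩ ⟨g, rfl⟩
        have hfg : MemLp (fun x => f x * g x) ∞ μ := (Lp.memLp g).mul (Lp.memLp f)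
        refine ⟨hfg.toLp, ?_⟩
        ext u
        exact stoneValue_eq hfg.coeFn_toLp ((tendsto_stoneValue f u).mul (tendsto_stoneValue g u))
      add_mem' := by
        rintro _ _ ⟨f, rfl⟩ ⟨g, rfl⟩
        exact ⟨f + g, map_add _ _ _⟩
      algebraMap_mem' := by
        intro c
        have hc : MemLp (fun _ : α => c) ∞ μ := memLp_top_const c
        refine ⟨hc.toLp, ?_⟩
        ext u
        exact stoneValue_eq hc.coeFn_toLp tendsto_const_nhds }
  have hclosed : IsClosed (R : Set C(BoolUltrafilter (MeasureAlgebra μ), ℝ)) :=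
    (stoneLI μ).isometry.isClosedEmbedding.isClosed_range
  have hsep : R.SeparatesPoints := by
    intro u v huv
    obtain ⟨a, ha, hb⟩ : ∃ a, a ∈ u.carrier ∧ a ∉ v.carrier := by
      by_contra! h
      apply huv
      ext a
      refine ⟨h a, fun hv => ?_⟩
      by_contra hu
      exact (compl_mem_iff v a).1 (h _ ((compl_mem_iff u a).2 hu)) hv
    obtain ⟨⟨A, hA⟩, rfl⟩ := Quotient.exists_rep a
    refine ⟨_, ⟨_, ⟨(memLp_indicator_one μ hA).toLp, rfl⟩, rfl⟩, ?_⟩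
    change stoneMap _ u ≠ stoneMap _ v
    rw [stoneMap_indicator, stoneMap_indicator, Set.indicator_of_mem (by exact ha),
      Set.indicator_of_notMem (by exact hb)]
    exact one_ne_zero
  have htop := ContinuousMap.subalgebra_topologicalClosure_eq_top_of_separatesPoints R hsep
  intro g
  have hg : g ∈ R.topologicalClosure := by rw [htop]; trivial
  have : g ∈ closure (R : Set C(BoolUltrafilter (MeasureAlgebra μ), ℝ)) := hg
  rw [hclosed.closure_eq] at this
  exact this

/-- The canonical isometric identification of `L^∞` with the space of continuous functions on the
Stone space of the measure algebra. -/
def stoneEquiv (μ : Measure α) : Lp ℝ ∞ μ ≃ₗᵢ[ℝ] C(BoolUltrafilter (MeasureAlgebra μ), ℝ) :=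
  LinearIsometryEquiv.ofSurjective (stoneLI μ) (stoneLI_surjective μ)

theorem memLp_indicatorMul (A : Set α) (hA : MeasurableSet A) (f : Lp ℝ ∞ μ) :
    MemLp (A.indicator (f : α → ℝ)) ∞ μ :=
  (Lp.memLp f).indicator hA

/-- The product `1_A f` of `f ∈ L^∞` with the indicator function of `A`. -/
def indicatorMul (A : Set α) (hA : MeasurableSet A) (f : Lp ℝ ∞ μ) : Lp ℝ ∞ μ :=
  (memLp_indicatorMul A hA f).toLp (A.indicator (f : α → ℝ))

theorem coeFn_indicatorMul (A : Set α) (hA : MeasurableSet A) (f : Lp ℝ ∞ μ) :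
    (indicatorMul A hA f : α → ℝ) =ᵐ[μ] A.indicator (f : α → ℝ) :=
  MemLp.coeFn_toLp (memLp_indicatorMul A hA f)

/-- The operator `1_A · I` on `L^∞`, that is, `f ↦ 1_A f`. -/
def indicatorOp (μ : Measure α) (A : Set α) (hA : MeasurableSet A) : Lp ℝ ∞ μ →L[ℝ] Lp ℝ ∞ μ :=
  LinearMap.mkContinuous
    { toFun := indicatorMul A hA
      map_add' := fun f g => by
        apply Lp.ext
        filter_upwards [coeFn_indicatorMul A hA (f + g), coeFn_indicatorMul A hA f,
          coeFn_indicatorMul A hA g, Lp.coeFn_add f g,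
          Lp.coeFn_add (indicatorMul A hA f) (indicatorMul A hA g)] with x h1 h2 h3 h4 h5
        rw [h1, h5, Pi.add_apply, h2, h3]
        by_cases hx : x ∈ A
        · rw [Set.indicator_of_mem hx, Set.indicator_of_mem hx, Set.indicator_of_mem hx, h4]
          rfl
        · rw [Set.indicator_of_notMem hx, Set.indicator_of_notMem hx, Set.indicator_of_notMem hx,
            add_zero]
      map_smul' := fun c f => by
        apply Lp.ext
        filter_upwards [coeFn_indicatorMul A hA (c • f), coeFn_indicatorMul A hA f,
          Lp.coeFn_smul c f, Lp.coeFn_smul c (indicatorMul A hA f)] with x h1 h2 h3 h4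
        rw [h1, RingHom.id_apply, h4, Pi.smul_apply, h2]
        by_cases hx : x ∈ A
        · rw [Set.indicator_of_mem hx, Set.indicator_of_mem hx, h3]
          rfl
        · rw [Set.indicator_of_notMem hx, Set.indicator_of_notMem hx, smul_zero] }
    1 fun f => by
      rw [one_mul]
      refine Lp.norm_le_norm_of_ae_le ?_
      filter_upwards [coeFn_indicatorMul A hA f] with x h1
      change ‖indicatorMul A hA f x‖ ≤ _
      rw [h1]
      exact norm_indicator_le_norm_self _ _

end MeasureAlgebra

section Annihilator

/-- The annihilator `S^⊥` in the dual space of a subspace `S` of a normed space. -/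
def dualAnn {E : Type*} [NormedAddCommGroup E] [NormedSpace ℝ E] (S : Submodule ℝ E) :
    Submodule ℝ (StrongDual ℝ E) where
  carrier := {F | ∀ x ∈ S, F x = 0}
  zero_mem' := fun _ _ => rfl
  add_mem' := fun {F G} hF hG x hx => by
    change F x + G x = 0
    rw [hF x hx, hG x hx, add_zero]
  smul_mem' := fun c F hF x hx => by
    change c • F x = 0
    rw [hF x hx, smul_zero]

end Annihilator

section RieszMeasure

/-- The regular signed Borel measure `ν` on the compact space `K` is the element of `M(K)` that is
identified with the functional `φ` on `C(K)`: `φ g = ∫ g dν` for all `g`, where the integral against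
a signed measure is the difference of those against its positive and negative parts. -/
def IsRieszMeasure {K : Type*} [TopologicalSpace K] [CompactSpace K] [MeasurableSpace K]
    [BorelSpace K] (φ : StrongDual ℝ C(K, ℝ)) (ν : SignedMeasure K) : Prop :=
  ν.totalVariation.Regular ∧
    ∀ g : C(K, ℝ), φ g = (∫ k, g k ∂ν.toJordanDecomposition.posPart) -
      ∫ k, g k ∂ν.toJordanDecomposition.negPart

end RieszMeasure

/-- `L^∞ = L^∞([0,1], m)` with Lebesgue measure `m`, over the reals. -/
abbrev Linf : Type := Lp ℝ ∞ (volume : Measure I)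

/-- The Banach algebra `B(L^∞)` of bounded linear operators. -/
abbrev BLinf : Type := Linf →L[ℝ] Linf

/-- The Stone space `𝔐` of the measure algebra of Lebesgue measure on `[0,1]`. -/
abbrev StoneM : Type := BoolUltrafilter (MeasureAlgebra (volume : Measure I))

/-- The left ideal of all `T ∈ B(L^∞)` such that `‖T ∘ (1_{[t,1]} · I)‖ → 0` as `t → 1`. -/
def idealI : Ideal BLinf where
  carrier := {T | Tendsto (fun t : I => ‖T ∘L indicatorOp volume (Set.Icc t 1) measurableSet_Icc‖)
    (𝓝[<] 1) (𝓝 0)}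
  zero_mem' := by
    refine (tendsto_const_nhds (x := (0 : ℝ))).congr fun t => ?_
    rw [ContinuousLinearMap.zero_comp, norm_zero]
  add_mem' := fun {S T} hS hT => by
    have h := Tendsto.add hS hT
    rw [add_zero] at h
    refine squeeze_zero (fun _ => norm_nonneg _) (fun t => ?_) h
    rw [ContinuousLinearMap.add_comp]
    exact norm_add_le _ _
  smul_mem' := fun S T hT => by
    have h := Tendsto.const_mul ‖S‖ hT
    rw [mul_zero] at h
    refine squeeze_zero (fun _ => norm_nonneg _) (fun t => ?_) h
    exact ContinuousLinearMap.opNorm_comp_le S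
      (T ∘L indicatorOp volume (Set.Icc t 1) measurableSet_Icc)

/-- `A = B(L^∞) ∩ I^⊥⊥`, where `B(L^∞)` is embedded canonically into its bidual. -/
def algA : Submodule ℝ BLinf :=
  (dualAnn (dualAnn (idealI.restrictScalars ℝ))).comap
    (NormedSpace.inclusionInDoubleDual ℝ BLinf).toLinearMap

/-- The set `M = ⋀_{t<1} ¬[0,t]` of all ultrafilters that contain the complement of `[0,t]` for
every `t < 1`. -/
def setM : Set StoneM :=
  {u | ∀ t : I, t < 1 →
    MeasureAlgebra.mk volume (Set.Icc 0 t)ᶜ measurableSet_Icc.compl ∈ u.carrier}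

/-- The functional `x* ∘ T` on `C(𝔐)`, where `T ∈ B(L^∞)` acts on `C(𝔐)` through the identification
of `C(𝔐)` with `L^∞`. -/
def compFunctional (x : StrongDual ℝ C(StoneM, ℝ)) (T : BLinf) : StrongDual ℝ C(StoneM, ℝ) :=
  x ∘L (stoneEquiv (volume : Measure I)).toContinuousLinearEquiv.toContinuousLinearMap ∘L T ∘L
    (stoneEquiv (volume : Measure I)).symm.toContinuousLinearEquiv.toContinuousLinearMap

end Stone

end

/-! ### The ideal as its own bidual trace, and clopen localization in the Stone space. -/

section Ideal

namespace Stone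

/-! The ideal `idealI` is norm closed, so by Hahn-Banach its double annihilator meets the original
space in the ideal itself (`mem_algA_iff`). Hence `algA` is a left ideal, and each of its elements
satisfies `‖T ∘ 1_[t,1]‖ → 0`.

On the Stone space, multiplication by `1_[t,1]` becomes multiplication by the indicator of a clopen
set `U_t` containing `M`. So `x ∘ T` has norm at most `‖x‖ * ‖T ∘ 1_[t,1]‖` on the functions
supported in `U_t` (`abs_compFunctional_le`). For a representing regular measure this bounds the
total variation of `U_t` (`IsRieszMeasure.totalVariation_le`), and letting `t → 1` gives `|μ|(M) =
0`. Existence of `μ` is the Riesz theorem for signed functionals, reduced to the positive case by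
splitting off the positive part. -/

/-- A subspace `S` that is closed is the preimage of its double annihilator in the bidual. -/
theorem mem_of_inclusionInDoubleDual_mem_dualAnn_dualAnn {E : Type*} [NormedAddCommGroup E]
    [NormedSpace ℝ E] {S : Submodule ℝ E} (hS : IsClosed (S : Set E)) {x : E}
    (hx : NormedSpace.inclusionInDoubleDual ℝ E x ∈ dualAnn (dualAnn S)) : x ∈ S := by
  by_contra hxS
  obtain ⟨f, u, hfu, hu⟩ := geometric_hahn_banach_point_closed S.convex hS hxS
  have hf : f ∈ dualAnn S := by
    intro y hy
    by_contra hne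
    -- On `S` the functional `f` is bounded below by `u`; this multiple of `y` would give it the
    -- value `u - 1`.
    have h := hu _ (S.smul_mem ((u - 1) / f y) hy)
    rw [map_smul, smul_eq_mul, div_mul_cancel₀ _ hne] at h
    linarith
  have h0 : f x = 0 := hx f hf
  have h1 := hu 0 S.zero_mem
  rw [map_zero] at h1
  linarith

theorem norm_indicatorOp_le {α : Type*} [MeasurableSpace α] (μ : Measure α) (A : Set α)
    (hA : MeasurableSet A) : ‖indicatorOp μ A hA‖ ≤ 1 :=
  LinearMap.mkContinuous_norm_le _ zero_le_one _

/-- Composing with `1_[t,1]` on the right is contractive, so norm approximation is uniform in `t`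
and preserves the limit condition. -/
theorem isClosed_idealI : IsClosed (idealI : Set BLinf) := by
  refine isClosed_of_closure_subset fun T hT => ?_
  change Tendsto _ _ _
  refine Metric.tendsto_nhds.2 fun ε hε => ?_
  obtain ⟨S, hS, hd⟩ := Metric.mem_closure_iff.1 hT (ε / 2) (half_pos hε)
  have hS' : Tendsto (fun t : I => ‖S ∘L indicatorOp volume (Set.Icc t 1) measurableSet_Icc‖)
    (𝓝[<] 1) (𝓝 0) := hS
  filter_upwards [Metric.tendsto_nhds.1 hS' (ε / 2) (half_pos hε)] with t ht
  rw [Real.dist_0_eq_abs, abs_of_nonneg (norm_nonneg _)] at ht ⊢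
  set P := indicatorOp (volume : Measure I) (Set.Icc t 1) measurableSet_Icc
  have h1 : T ∘L P = (T - S) ∘L P + S ∘L P := by
    rw [ContinuousLinearMap.sub_comp, sub_add_cancel]
  have h2 : ‖(T - S) ∘L P‖ ≤ ‖T - S‖ := by
    refine ((T - S).opNorm_comp_le P).trans ?_
    exact mul_le_of_le_one_right (norm_nonneg _) (norm_indicatorOp_le _ _ _)
  rw [dist_eq_norm] at hd
  rw [h1]
  have := norm_add_le ((T - S) ∘L P) (S ∘L P)
  linarith

theorem mem_algA_iff {T : BLinf} : T ∈ algA ↔ T ∈ idealI :=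
  ⟨fun h => mem_of_inclusionInDoubleDual_mem_dualAnn_dualAnn (S := idealI.restrictScalars ℝ)
    isClosed_idealI h, fun h _ hf => hf T h⟩

/-- An ultrafilter contains the class of `A` or that of its complement: along it `1_A f` eventually
agrees with `f` or with `0`. -/
theorem stoneEquiv_indicatorOp {α : Type*} [MeasurableSpace α] {μ : Measure α} {A : Set α}
    (hA : MeasurableSet A) (f : Lp ℝ ∞ μ) (u : BoolUltrafilter (MeasureAlgebra μ)) :
    stoneEquiv μ (indicatorOp μ A hA f) u =
      (basicClopen (MeasureAlgebra.mk μ A hA)).indicator (stoneEquiv μ f) u := by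
  refine stoneValue_eq (coeFn_indicatorMul A hA f) ?_
  by_cases h : u ∈ basicClopen (MeasureAlgebra.mk μ A hA)
  · rw [Set.indicator_of_mem h]
    refine (tendsto_stoneValue f u).congr' ?_
    filter_upwards [(mem_pointFilter hA).2 h] with x hx
    exact (Set.indicator_of_mem hx _).symm
  · rw [Set.indicator_of_notMem h]
    refine tendsto_const_nhds.congr' ?_
    have h' : Aᶜ ∈ pointFilter u := (mem_pointFilter hA.compl).2 ((compl_mem_iff u _).2 h)
    filter_upwards [h'] with x hx
    exact (Set.indicator_of_notMem hx _).symm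

theorem indicatorOp_stoneEquiv_symm {α : Type*} [MeasurableSpace α] {μ : Measure α} {A : Set α}
    (hA : MeasurableSet A) {g : C(BoolUltrafilter (MeasureAlgebra μ), ℝ)}
    (hg : ∀ u ∉ basicClopen (MeasureAlgebra.mk μ A hA), g u = 0) :
    indicatorOp μ A hA ((stoneEquiv μ).symm g) = (stoneEquiv μ).symm g := by
  apply (stoneEquiv μ).injective
  ext u
  rw [stoneEquiv_indicatorOp, LinearIsometryEquiv.apply_symm_apply]
  by_cases h : u ∈ basicClopen (MeasureAlgebra.mk μ A hA)
  · rw [Set.indicator_of_mem h]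
  · rw [Set.indicator_of_notMem h, hg u h]

/-- On functions supported in the clopen set of `A`, the functional `x ∘ T` only sees `T ∘ 1_A`. -/
theorem abs_compFunctional_le (x : StrongDual ℝ C(StoneM, ℝ)) (T : BLinf) {A : Set I}
    (hA : MeasurableSet A) {g : C(StoneM, ℝ)}
    (hg : ∀ u ∉ basicClopen (MeasureAlgebra.mk volume A hA), g u = 0) :
    |compFunctional x T g| ≤ ‖x‖ * ‖T ∘L indicatorOp volume A hA‖ * ‖g‖ := by
  have h : compFunctional x T g =
      x (stoneEquiv volume ((T ∘L indicatorOp volume A hA) ((stoneEquiv volume).symm g))) := by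
    rw [ContinuousLinearMap.comp_apply, indicatorOp_stoneEquiv_symm hA hg]
    rfl
  rw [h, ← Real.norm_eq_abs, mul_assoc]
  refine (x.le_opNorm _).trans (mul_le_mul_of_nonneg_left ?_ (norm_nonneg _))
  rw [LinearIsometryEquiv.norm_map]
  refine (ContinuousLinearMap.le_opNorm _ _).trans ?_
  rw [LinearIsometryEquiv.norm_map]

/-- The complement of `[0,t]` is `(t,1]`, which lies in `[t,1]`, and ultrafilters are upward closed.
-/
theorem setM_subset_basicClopen {t : I} (ht : t < 1) :
    setM ⊆ basicClopen (MeasureAlgebra.mk volume (Set.Icc t 1) measurableSet_Icc) := by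
  intro u hu
  refine u.mem_of_le _ _ (MeasureAlgebra.mk_le_mk _ _ (Eventually.of_forall fun s hs => ?_))
    (hu t ht)
  exact ⟨(not_le.1 fun h => hs ⟨s.2.1, h⟩).le, s.2.2⟩

end Stone

end Ideal

/-! ### Riesz representation by regular signed measures, and total variation of clopen sets. -/

section Riesz

open scoped NNReal CompactlySupported

theorem ContinuousMap.norm_le_of_nonneg_of_le {X : Type*} [TopologicalSpace X]
    [CompactSpace X] {f g : C(X, ℝ)} (hg : 0 ≤ g) (h : g ≤ f) :
    ‖g‖ ≤ ‖f‖ :=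
  (ContinuousMap.norm_le _ (norm_nonneg _)).2 fun k => by
    have hk : 0 ≤ g k := hg k
    rw [Real.norm_of_nonneg hk]
    exact (h k).trans ((le_abs_self _).trans (f.norm_coe_le_norm k))

variable {K : Type*} [TopologicalSpace K] [MeasurableSpace K]
  [BorelSpace K]

/-- A measure dominated by a finite regular measure is regular. -/
theorem MeasureTheory.Measure.regular_of_le [T2Space K] {μ ρ : Measure K} [IsFiniteMeasure ρ]
    [ρ.Regular] (h : μ ≤ ρ) : μ.Regular := by
  have : IsFiniteMeasure μ := isFiniteMeasure_of_le ρ h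
  have : μ.InnerRegularCompactLTTop := by
    refine ⟨fun s hs r hr => ?_⟩
    -- A compact set that exhausts `s` for `ρ` up to `μ s - r` does so for the smaller measure `μ`,
    -- which forces `r < μ C`.
    obtain ⟨C, hCs, hC, hlt⟩ := hs.1.exists_isCompact_sdiff_lt (μ := ρ) (measure_ne_top ρ s)
      (tsub_pos_iff_lt.2 hr).ne'
    refine ⟨C, hCs, hC, ?_⟩
    have h1 : μ s ≤ μ C + μ (s \ C) := by
      refine (measure_mono ?_).trans (measure_union_le _ _)
      rw [Set.union_sdiff_self]
      exact subset_union_right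
    by_contra hle
    have h2 : μ s < r + (μ s - r) := by
      refine h1.trans_lt ((add_le_add_left (not_lt.1 hle) _).trans_lt ?_)
      exact ENNReal.add_lt_add_left hr.ne_top ((h _).trans_lt hlt)
    rw [add_tsub_cancel_of_le hr.le] at h2
    exact lt_irrefl _ h2
  infer_instance

variable [CompactSpace K]

/-- The Riesz–Markov–Kakutani theorem for a functional that is additive, homogeneous and nonnegative
on the cone of nonnegative functions. -/
theorem exists_regular_integral_eq [T2Space K] (L : C(K, ℝ) → ℝ)
    (hadd : ∀ f g, 0 ≤ f → 0 ≤ g → L (f + g) = L f + L g)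
    (hsmul : ∀ (c : ℝ) f, 0 ≤ c → 0 ≤ f → L (c • f) = c * L f)
    (hnonneg : ∀ f, 0 ≤ f → 0 ≤ L f) :
    ∃ μ : Measure K, IsFiniteMeasure μ ∧ μ.Regular ∧ ∀ f : C(K, ℝ), 0 ≤ f → L f = ∫ k, f k ∂μ := by
  let toC : C_c(K, ℝ≥0) → C(K, ℝ) := fun f => ⟨fun k => (f k : ℝ), by fun_prop⟩
  have htoC : ∀ f, 0 ≤ toC f := fun f k => (f k).2
  -- Linearity over the semiring `ℝ≥0` involves only the cone, so the three hypotheses suffice;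
  -- compact support is automatic on `K`.
  let Λ : C_c(K, ℝ≥0) →ₗ[ℝ≥0] ℝ≥0 :=
    { toFun := fun f => ⟨L (toC f), hnonneg _ (htoC f)⟩
      map_add' := fun f g => NNReal.eq (hadd _ _ (htoC f) (htoC g))
      map_smul' := fun c f => NNReal.eq (hsmul c _ c.2 (htoC f)) }
  have : IsFiniteMeasure (NNRealRMK.rieszMeasure Λ) :=
    ⟨isCompact_univ.measure_lt_top⟩
  refine ⟨NNRealRMK.rieszMeasure Λ, this, inferInstance, fun f hf => ?_⟩
  let f' : C_c(K, ℝ≥0) :=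
    ⟨⟨fun k => ⟨f k, hf k⟩, by fun_prop⟩, HasCompactSupport.of_compactSpace _⟩
  exact (NNRealRMK.integral_rieszMeasure Λ f').symm

/-- The positive part of a functional on the cone of nonnegative functions. -/
theorem exists_isLUB_image_Icc {X : Type*} [TopologicalSpace X] [CompactSpace X]
    (φ : StrongDual ℝ C(X, ℝ)) :
    ∃ N : C(X, ℝ) → ℝ, ∀ f, 0 ≤ f → IsLUB (φ '' Set.Icc 0 f) (N f) := by
  refine ⟨fun f => sSup (φ '' Set.Icc 0 f), fun f hf => isLUB_csSup ?_ ?_⟩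
  · exact ⟨_, 0, ⟨le_rfl, hf⟩, rfl⟩
  · refine ⟨‖φ‖ * ‖f‖, ?_⟩
    rintro _ ⟨g, hg, rfl⟩
    refine (le_abs_self _).trans ((φ.le_opNorm g).trans ?_)
    exact mul_le_mul_of_nonneg_left (ContinuousMap.norm_le_of_nonneg_of_le hg.1 hg.2)
      (norm_nonneg _)

/-- Every bounded functional on `C(K)` is a difference of integrals against regular measures. -/
theorem exists_regular_integral_sub_eq [T2Space K] (φ : StrongDual ℝ C(K, ℝ)) :
    ∃ μ ρ : Measure K, IsFiniteMeasure μ ∧ IsFiniteMeasure ρ ∧ μ.Regular ∧ ρ.Regular ∧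
      ∀ g : C(K, ℝ), φ g = (∫ k, g k ∂μ) - ∫ k, g k ∂ρ := by
  obtain ⟨N, hN⟩ := exists_isLUB_image_Icc φ
  have hadd : ∀ f g, 0 ≤ f → 0 ≤ g → N (f + g) = N f + N g := by
    intro f g hf hg
    refine (hN _ (add_nonneg hf hg)).unique ⟨?_, fun b hb => ?_⟩
    · rintro _ ⟨h, hh, rfl⟩
      -- Riesz decomposition: `0 ≤ h ≤ f + g` splits into `h ⊓ f ≤ f` and a remainder that is at
      -- most `g`.
      have h1 : φ (h ⊓ f) ≤ N f :=
        (hN f hf).1 ⟨_, ⟨le_inf hh.1 hf, inf_le_right⟩, rfl⟩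
      have h2 : φ (h - h ⊓ f) ≤ N g := by
        refine (hN g hg).1 ⟨_, ⟨sub_nonneg.2 inf_le_left, fun k => ?_⟩, rfl⟩
        have hk : h k ≤ f k + g k := hh.2 k
        have hgk : 0 ≤ g k := hg k
        change h k - min (h k) (f k) ≤ g k
        rcases min_choice (h k) (f k) with h' | h' <;> rw [h'] <;> linarith
      have h3 : φ h = φ (h ⊓ f) + φ (h - h ⊓ f) := by rw [← map_add, add_sub_cancel]
      rw [h3]
      exact add_le_add h1 h2
    · have h1 : N f ≤ b - N g := (hN f hf).2 <| by
        rintro _ ⟨p, hp, rfl⟩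
        rw [le_sub_comm]
        refine (hN g hg).2 ?_
        rintro _ ⟨q, hq, rfl⟩
        have := hb ⟨p + q, ⟨add_nonneg hp.1 hq.1, add_le_add hp.2 hq.2⟩, rfl⟩
        rw [map_add] at this
        linarith
      linarith
  have hsmul : ∀ (c : ℝ) f, 0 ≤ c → 0 ≤ f → N (c • f) = c * N f := by
    -- One inequality is enough: the other is this one for `c⁻¹` and `c • f`.
    have hle : ∀ (c : ℝ) f, 0 < c → 0 ≤ f → c * N f ≤ N (c • f) := by
      intro c f hc hf
      rw [← le_div_iff₀' hc]
      refine (hN f hf).2 ?_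
      rintro _ ⟨g, hg, rfl⟩
      rw [le_div_iff₀' hc]
      refine (hN _ (smul_nonneg hc.le hf)).1 ⟨c • g, ⟨smul_nonneg hc.le hg.1, ?_⟩, map_smul _ _ _⟩
      exact smul_le_smul_of_nonneg_left hg.2 hc.le
    intro c f hc hf
    rcases hc.eq_or_lt with rfl | hc
    · rw [zero_smul, zero_mul]
      have := hadd 0 0 le_rfl le_rfl
      rw [add_zero] at this
      linarith
    · refine le_antisymm ?_ (hle c f hc hf)
      have := hle c⁻¹ (c • f) (inv_pos.2 hc) (smul_nonneg hc.le hf)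
      rwa [inv_smul_smul₀ hc.ne', inv_mul_le_iff₀ hc] at this
  obtain ⟨μ, hμf, hμr, hμ⟩ := exists_regular_integral_eq N hadd hsmul fun f hf =>
    (hN f hf).1 ⟨0, ⟨le_rfl, hf⟩, map_zero φ⟩
  -- `N - φ` is the negative part of `φ`; it is nonnegative on the cone because `f` itself competes
  -- in the supremum `N f`.
  obtain ⟨ρ, hρf, hρr, hρ⟩ := exists_regular_integral_eq (fun f => N f - φ f)
    (fun f g hf hg => by rw [hadd f g hf hg, map_add]; ring)
    (fun c f hc hf => by rw [hsmul c f hc hf, map_smul, smul_eq_mul]; ring)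
    (fun f hf => sub_nonneg.2 ((hN f hf).1 ⟨f, ⟨hf, le_rfl⟩, rfl⟩))
  refine ⟨μ, ρ, hμf, hρf, hμr, hρr, fun g => ?_⟩
  have hpos : ∀ f : C(K, ℝ), 0 ≤ f → φ f = (∫ k, f k ∂μ) - ∫ k, f k ∂ρ := by
    intro f hf
    rw [← hμ f hf, ← hρ f hf]
    ring
  have hint : ∀ (κ : Measure K) [IsFiniteMeasure κ] (f : C(K, ℝ)), Integrable f κ := fun κ _ f =>
    f.continuous.integrable_of_hasCompactSupport (HasCompactSupport.of_compactSpace _)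
  have hsub : ∀ (κ : Measure K) [IsFiniteMeasure κ],
      ∫ k, g k ∂κ = (∫ k, g⁺ k ∂κ) - ∫ k, g⁻ k ∂κ := by
    intro κ _
    rw [← integral_sub (hint κ _) (hint κ _)]
    refine integral_congr_ae (Eventually.of_forall fun k => ?_)
    conv_lhs => rw [← posPart_sub_negPart g]
    rfl
  rw [hsub μ, hsub ρ]
  conv_lhs => rw [← posPart_sub_negPart g]
  rw [map_sub, hpos _ (posPart_nonneg g), hpos _ (negPart_nonneg g)]
  ring

/-- Subtraction of measures is truncated, and both sides are the supremum of `μ` and `ρ`. This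
trades integrals against the Jordan parts of a difference for integrals against `μ` and `ρ`, which
need not be mutually singular. -/
theorem MeasureTheory.Measure.sub_add_eq_sub_add {X : Type*} [MeasurableSpace X] (μ ρ : Measure X)
    [IsFiniteMeasure μ] [IsFiniteMeasure ρ] : (μ - ρ) + ρ = (ρ - μ) + μ := by
  have h := Measure.sub_toSignedMeasure_eq_toSignedMeasure_sub (μ := μ) (ν := ρ)
  refine Measure.toSignedMeasure_eq_toSignedMeasure_iff.1 ?_
  rw [Measure.toSignedMeasure_add, Measure.toSignedMeasure_add]
  rw [sub_eq_sub_iff_add_eq_add] at h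
  rw [← h]
  exact add_comm _ _

namespace Stone

/-- The Riesz representation theorem: every bounded functional on `C(K)` is integration against a
regular signed Borel measure. -/
theorem exists_isRieszMeasure [T2Space K] (φ : StrongDual ℝ C(K, ℝ)) :
    ∃ ν : SignedMeasure K, IsRieszMeasure φ ν := by
  obtain ⟨μ, ρ, _, _, _, _, h⟩ := exists_regular_integral_sub_eq φ
  have hint : ∀ (κ : Measure K) [IsFiniteMeasure κ] (f : C(K, ℝ)), Integrable f κ := fun κ _ f =>
    f.continuous.integrable_of_hasCompactSupport (HasCompactSupport.of_compactSpace _)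
  refine ⟨μ.toSignedMeasure - ρ.toSignedMeasure, ?_, fun g => ?_⟩
  · rw [SignedMeasure.totalVariation, Measure.toJordanDecomposition_toSignedMeasure_sub]
    -- The Jordan parts are the truncated differences `μ - ρ ≤ μ` and `ρ - μ ≤ ρ`.
    exact Measure.regular_of_le (ρ := μ + ρ) (add_le_add Measure.sub_le Measure.sub_le)
  · rw [Measure.toJordanDecomposition_toSignedMeasure_sub, h g,
      Measure.jordanDecompositionOfToSignedMeasureSub_posPart,
      Measure.jordanDecompositionOfToSignedMeasureSub_negPart]
    have h1 := congrArg (fun κ => ∫ k, g k ∂κ) (Measure.sub_add_eq_sub_add μ ρ)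
    beta_reduce at h1
    rw [integral_add_measure (hint _ g) (hint _ g), integral_add_measure (hint _ g) (hint _ g)] at h1
    linarith

/-- The total variation of a clopen set is at most the norm of the functional on the functions
supported in that set. -/
theorem IsRieszMeasure.totalVariation_le [T2Space K] {φ : StrongDual ℝ C(K, ℝ)} {ν : SignedMeasure K}
    (h : IsRieszMeasure φ ν) {U : Set K} (hU : IsClopen U) {C : ℝ} (hC : 0 ≤ C)
    (hφ : ∀ g : C(K, ℝ), (∀ k ∉ U, g k = 0) → |φ g| ≤ C * ‖g‖) :
    ν.totalVariation U ≤ ENNReal.ofReal C := by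
  set p := ν.toJordanDecomposition.posPart
  set n := ν.toJordanDecomposition.negPart
  have hT : ν.totalVariation = p + n := rfl
  have := h.1
  have hfin : IsFiniteMeasure ν.totalVariation := by rw [hT]; infer_instance
  obtain ⟨S, hS, hpS, hnS⟩ := ν.toJordanDecomposition.mutuallySingular
  -- `s` is the sign of `ν`, its density with respect to the total variation: `p` lives on `Sᶜ` and
  -- `n` on `S`.
  set s : K → ℝ := Sᶜ.indicator 1 - S.indicator 1 with hs
  have hs_p : ∀ᵐ k ∂p, s k = 1 := by
    filter_upwards [measure_eq_zero_iff_ae_notMem.1 hpS] with k hk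
    simp [hs, hk]
  have hs_n : ∀ᵐ k ∂n, s k = -1 := by
    filter_upwards [measure_eq_zero_iff_ae_notMem.1 hnS] with k hk
    have : k ∈ S := not_not.1 hk
    simp [hs, this]
  have hs_int : Integrable s ν.totalVariation :=
    ((integrable_const (1 : ℝ)).indicator hS.compl).sub ((integrable_const (1 : ℝ)).indicator hS)
  have hs_abs : ∀ k, |s k| = 1 := by
    intro k
    by_cases hk : k ∈ S <;> simp [hs, hk]
  have hint : ∀ (κ : Measure K) [IsFiniteMeasure κ] (f : C(K, ℝ)), Integrable f κ := fun κ _ f =>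
    f.continuous.integrable_of_hasCompactSupport (HasCompactSupport.of_compactSpace _)
  refine ENNReal.le_ofReal_iff_toReal_le (measure_ne_top _ _) hC |>.2 ?_
  refine le_of_forall_pos_le_add fun ε hε => ?_
  -- Regularity of the total variation enters here, as density of continuous functions in `L¹`.
  obtain ⟨g, hg, -⟩ := hs_int.exists_boundedContinuous_integral_sub_le hε
  -- Clamping to `[-1,1]` gives norm at most `1`, and cutting off to `U` keeps continuity because a
  -- clopen set has empty frontier.
  let g' : C(K, ℝ) := ⟨U.indicator fun k => max (-1) (min 1 (g k)),
    Continuous.indicator (by simp [hU.frontier_eq]) (by fun_prop)⟩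
  have hg'U : ∀ k ∈ U, g' k = max (-1) (min 1 (g k)) := fun k hk =>
    Set.indicator_of_mem hk (fun k => max (-1) (min 1 (g k)))
  have hg'0 : ∀ k ∉ U, g' k = 0 := fun k hk =>
    Set.indicator_of_notMem hk (fun k => max (-1) (min 1 (g k)))
  have hnorm : ‖g'‖ ≤ 1 := by
    refine (ContinuousMap.norm_le _ zero_le_one).2 fun k => ?_
    by_cases hk : k ∈ U
    · rw [hg'U k hk, Real.norm_eq_abs, abs_le]
      exact ⟨le_max_left _ _, max_le (by norm_num) (min_le_left _ _)⟩
    · rw [hg'0 k hk, norm_zero]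
      exact zero_le_one
  have hsg : Integrable (fun k => s k * g' k) ν.totalVariation :=
    (hint _ g').bdd_mul hs_int.aestronglyMeasurable
      (Eventually.of_forall fun k => (hs_abs k).le)
  have hφg : φ g' = ∫ k, s k * g' k ∂ν.totalVariation := by
    have hsg' := hsg
    rw [hT] at hsg' ⊢
    rw [integral_add_measure hsg'.left_of_add_measure hsg'.right_of_add_measure, h.2 g',
      sub_eq_add_neg, ← integral_neg]
    congr 1
    · refine integral_congr_ae ?_
      filter_upwards [hs_p] with k hk
      rw [hk, one_mul]
    · refine integral_congr_ae ?_
      filter_upwards [hs_n] with k hk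
      rw [hk, neg_one_mul]
  -- On `U` the left side is `|s - g'|`, and clamping cannot increase the distance to `s = ±1`; off
  -- `U` it is `0`. Integrated, this says that `φ g'` is within `ε` of the total variation of `U`
  -- from below.
  have hkey : ∀ k, U.indicator (fun _ => (1 : ℝ)) k - s k * g' k ≤ ‖s k - g k‖ := by
    intro k
    by_cases hk : k ∈ U
    · rw [Set.indicator_of_mem hk, hg'U k hk, Real.norm_eq_abs]
      rcases eq_or_eq_neg_of_abs_eq (hs_abs k) with h1 | h1
      · rw [h1]
        have h2 := le_abs_self (1 - g k)
        have h3 := abs_nonneg (1 - g k)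
        have : 1 - |1 - g k| ≤ min 1 (g k) := le_min (by linarith) (by linarith)
        have := le_max_right (-1) (min 1 (g k))
        linarith
      · rw [h1]
        have h2 := neg_le_abs (-1 - g k)
        have h3 := abs_nonneg (-1 - g k)
        have : max (-1) (min 1 (g k)) ≤ -1 + |-1 - g k| :=
          max_le (by linarith) ((min_le_right _ _).trans (by linarith))
        linarith
    · rw [Set.indicator_of_notMem hk, hg'0 k hk, mul_zero, sub_zero]
      exact norm_nonneg _
  have hU1 : Integrable (U.indicator fun _ => (1 : ℝ)) ν.totalVariation :=
    (integrable_const 1).indicator hU.isOpen.measurableSet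
  have h1 : (ν.totalVariation U).toReal - φ g' ≤ ε := by
    have h2 : (ν.totalVariation U).toReal =
        ∫ k, U.indicator (fun _ => (1 : ℝ)) k ∂ν.totalVariation := by
      rw [integral_indicator hU.isOpen.measurableSet, setIntegral_const, smul_eq_mul, mul_one]
      rfl
    rw [h2, hφg, ← integral_sub hU1 hsg]
    refine (integral_mono (hU1.sub hsg) ?_ hkey).trans hg
    exact (hs_int.sub (g.integrable _)).norm
  have h2 : φ g' ≤ C := (le_abs_self _).trans ((hφ g' hg'0).trans (mul_le_of_le_one_right hC hnorm))
  linarith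

end Stone

end Riesz

/-! ### The left ideal property and vanishing on `M`. -/

theorem mainTheorem10 :
    (∀ S T : Stone.BLinf, T ∈ Stone.algA → S * T ∈ Stone.algA) ∧
    ∀ T ∈ Stone.algA, ∀ x : StrongDual ℝ C(Stone.StoneM, ℝ),
      (∃ ν : SignedMeasure Stone.StoneM,
        Stone.IsRieszMeasure (Stone.compFunctional x T) ν) ∧
      ∀ ν : SignedMeasure Stone.StoneM,
        Stone.IsRieszMeasure (Stone.compFunctional x T) ν →
          ν.totalVariation Stone.setM = 0 := by
  refine ⟨fun S T hT => ?_, fun T hT x => ⟨Stone.exists_isRieszMeasure _, fun ν hν => ?_⟩⟩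
  · rw [Stone.mem_algA_iff] at hT ⊢
    exact Stone.idealI.mul_mem_left S hT
  have hT' : Tendsto
      (fun t : I => ‖T ∘L Stone.indicatorOp volume (Set.Icc t 1) measurableSet_Icc‖)
      (𝓝[<] 1) (𝓝 0) := Stone.mem_algA_iff.1 hT
  have hlim := ENNReal.tendsto_ofReal (hT'.const_mul ‖x‖)
  rw [mul_zero, ENNReal.ofReal_zero] at hlim
  -- The point `1` is a left limit point of `[0,1]`; otherwise the limit along `t → 1` would carry
  -- no information.
  have hne : (𝓝[<] (1 : I)).NeBot := nhdsLT_neBot_of_exists_lt ⟨0, zero_lt_one⟩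
  refine le_antisymm (ge_of_tendsto hlim ?_) zero_le
  filter_upwards [self_mem_nhdsWithin] with t ht
  refine (measure_mono (Stone.setM_subset_basicClopen ht)).trans ?_
  refine hν.totalVariation_le ⟨?_, Stone.isOpen_basicClopen _⟩ (by positivity) fun g hg =>
    Stone.abs_compFunctional_le x T measurableSet_Icc hg
  rw [← isOpen_compl_iff, ← Stone.basicClopen_compl]
  exact Stone.isOpen_basicClopen _
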